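/- A translation surface $X$ is a closed oriented surface obtained from finitely many Euclidean polygons (without loss of generality, triangles) in $\mathbb{C}$ by gluing their sides in pairs by translations; it carries a flat metric with conical singularities of angles in $2\pi\mathbb{N}$. For $g\ge 2$, the minimal stratum $\mathcal{H}(2g-2)$ is the set of connected translation surfaces with exactly one singular point, of cone angle $2\pi(2g-1)$ (they have genus $g$). Put $$\mathrm{KVol}(X)=\mathrm{Vol}(X)\,\sup_{\alpha,\beta}\frac{\mathrm{Int}(\alpha,\beta)}{l(\alpha)\,l(\beta)},$$ where the supremum ranges over all pairs of piecewise smooth closed curves of positive length on $X$, $\mathrm{Int}$ is the algebraic intersection, $l$ the length and $\mathrm{Vol}$ the area. For integers $g\ge 2$, $n\ge 1$, let $L_g^n$ be the staircase surface made of $g$ rectangles $R_1,\dots,R_g$ and $g-1$ unit squares $C_1,\dots,C_{g-1}$, where $R_i$ is $1$ wide and $n$ high for odd $i$, and $n$ wide and $1$ high for even $i$. For even $i$ the rectangles $C_{i-1},R_i,C_i$ form, in this order from left to right, one horizontal cylinder, and for odd $i$ the rectangles $C_{i-1},R_i,C_i$ form, in this order from top to bottom, one vertical cylinder (where $C_0$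 and $C_g$ are omitted); moreover the left and right sides of $R_i$ for $i$ odd, and the top and bottom sides of $R_i$ for $i$ even, are glued to each other. Thus $L_g^n$ is tiled by $g(n+1)-1$ unit squares. Theorem. For every $g\ge 2$, $$\inf_{X\in\mathcal{H}(2g-2)}\mathrm{KVol}(X)\le g .$$ Moreover, for all $n\ge 2$, the surface $L_g^n$ lies in $\mathcal{H}(2g-2)$, has area $g(n+1)-1$, and satisfies $$\frac{g(n+1)-1}{n}\;\le\;\mathrm{KVol}(L_g^n)\;\le\;\bigl(g(n+1)-1\bigr)\left(\frac{(n+1)^2}{n^3}+\frac{6}{n^2}\right),$$ so that $\mathrm{KVol}(L_g^n)\to g$ as $n\to\infty$. -/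

import Mathlib

open Set Filter Topology MeasureTheory
open scoped ENNReal ContDiff

noncomputable section

/-- A (compact, triangulated) translation surface: finitely many nondegenerate, positively
oriented Euclidean triangles in `ℂ`, whose sides are glued in pairs by translations.
Side `(t, i)` of triangle `t` runs from vertex `i` to vertex `i + 1` (indices mod `3`); the gluing
exchanges side `e` with side `glue e`, reversing the boundary orientation. -/
structure TranslationSurface where
  /-- the (finite) index set of the triangles -/
  T : Type
  [fintypeT : Fintype T]
  /-- the vertices of the triangles, in counterclockwise order -/
  vert : T → Fin 3 → ℂ
  /-- the side glued to a given side -/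
  glue : T × Fin 3 → T × Fin 3
  orientation_pos : ∀ t, 0 < (vert t 1 - vert t 0).re * (vert t 2 - vert t 0).im
    - (vert t 1 - vert t 0).im * (vert t 2 - vert t 0).re
  glue_glue : ∀ e, glue (glue e) = e
  glue_vert : ∀ e, vert (glue e).1 ((glue e).2 + 1) - vert (glue e).1 (glue e).2
    = -(vert e.1 (e.2 + 1) - vert e.1 e.2)

namespace TranslationSurface

attribute [instance] TranslationSurface.fintypeT

variable (X : TranslationSurface)

/-- The vector of the side `(t, i)`. -/
def side (e : X.T × Fin 3) : ℂ := X.vert e.1 (e.2 + 1) - X.vert e.1 e.2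

/-- The closed triangle `t`. -/
def triangle (t : X.T) : Set ℂ := convexHull ℝ (range (X.vert t))

/-- The Euclidean area of triangle `t`. -/
def area (t : X.T) : ℝ :=
  ((X.vert t 1 - X.vert t 0).re * (X.vert t 2 - X.vert t 0).im
    - (X.vert t 1 - X.vert t 0).im * (X.vert t 2 - X.vert t 0).re) / 2

/-- `Vol(X)`, the total area. -/
def vol : ℝ := ∑ t, X.area t

/-! ### Cone points and the minimal stratum -/

/-- Two corners are at the same vertex of the surface: the equivalence relation generated by turning
counterclockwise from the corner `(t, i)` across the side `(t, i - 1)`. -/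
def SameVertex : X.T × Fin 3 → X.T × Fin 3 → Prop :=
  Relation.EqvGen fun c c' => c' = X.glue (c.1, c.2 + 2)

/-- The interior angle of a triangle at one of its corners. -/
def cornerAngle (c : X.T × Fin 3) : ℝ :=
  EuclideanGeometry.angle (X.vert c.1 (c.2 + 1)) (X.vert c.1 c.2) (X.vert c.1 (c.2 + 2))

open Classical in
/-- The total angle of the surface around the vertex at which the corner `c` lies. -/
def coneAngle (c : X.T × Fin 3) : ℝ := ∑ c' with X.SameVertex c c', X.cornerAngle c'

/-- The surface is connected. -/
def IsConnected : Prop :=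
  ∀ t t' : X.T, Relation.EqvGen (fun a b => ∃ i, (X.glue (a, i)).1 = b) t t'

/-- The minimal stratum `H(2g-2)`: connected translation surfaces with exactly one zero, of order
`2g - 2`, i.e. one vertex has total angle `2π(2g-1)` and all the others are regular points.
(By Gauss-Bonnet such a surface has genus `g`.) -/
def minimalStratum (g : ℕ) : Set TranslationSurface :=
  {X | X.IsConnected ∧ ∃ c₀ : X.T × Fin 3, X.coneAngle c₀ = 2 * Real.pi * (2 * (g : ℝ) - 1) ∧
    ∀ c, ¬ X.SameVertex c₀ c → X.coneAngle c = 2 * Real.pi}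

/-! ### Points and closed curves -/

/-- Identification of the points of a side with the points of the side glued to it. -/
def GlueRel (x y : {x : X.T × ℂ // x.2 ∈ X.triangle x.1}) : Prop :=
  ∃ (i : Fin 3) (u : ℝ), u ∈ Icc (0 : ℝ) 1 ∧
    x.1.2 = X.vert x.1.1 i + u * X.side (x.1.1, i) ∧
    y.1.1 = (X.glue (x.1.1, i)).1 ∧
    y.1.2 = X.vert y.1.1 ((X.glue (x.1.1, i)).2 + 1) + u * X.side (x.1.1, i)

/-- The underlying set of the surface: the quotient of the disjoint union of the closed triangles by
the equivalence relation generated by the gluings. -/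
def Point : Type := Quot X.GlueRel

/-- The point of the surface given by the point `p` of the closed triangle `t`. -/
def pt (t : X.T) (p : ℂ) (hp : p ∈ X.triangle t) : X.Point := Quot.mk _ ⟨(t, p), hp⟩

/-- The straight segment in the closed triangle `t` with displacement vector `v` leads from the
point `x` to the point `y`. -/
def Joins (t : X.T) (x y : X.Point) (v : ℂ) : Prop :=
  ∃ (p q : ℂ) (hp : p ∈ X.triangle t) (hq : q ∈ X.triangle t),
    X.pt t p hp = x ∧ X.pt t q hq = y ∧ q - p = v

/-- A piecewise smooth closed curve `[0,1] → X`, with its development `dev : [0,1] → ℂ`, that is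
`dev s - dev 0` is the integral of the holomorphic one-form `dz` along the curve up to time `s`.
Near every time the curve moves by the displacement of its development, inside a triangle; as `dev`
is continuous, this makes the curve continuous. The curve may run through cone points. -/
structure ClosedCurve where
  toFun : ℝ → X.Point
  dev : ℝ → ℂ
  closed : toFun 0 = toFun 1
  piecewise_smooth : ∃ (N : ℕ) (s : Fin (N + 1) → ℝ), StrictMono s ∧ s 0 = 0 ∧
    s (Fin.last N) = 1 ∧
    ∀ k : Fin N, ContDiffOn ℝ ∞ dev (Icc (s k.castSucc) (s k.succ))
  develops : ∀ s ∈ Icc (0 : ℝ) 1, ∀ᶠ s' in 𝓝[Icc (0 : ℝ) 1] s,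
    ∃ t, X.Joins t (toFun s) (toFun s') (dev s' - dev s)

variable {X} in
/-- The length of a closed curve, `∫ |γ'|`. -/
def ClosedCurve.length (γ : X.ClosedCurve) : ℝ≥0∞ :=
  ∫⁻ s in Icc (0 : ℝ) 1, ‖deriv γ.dev s‖ₑ

/-! ### The algebraic intersection form

The real cohomology of the surface is represented by closed one-forms that are constant on each
triangle (these are the simplicial one-cocycles of the triangulation), and the algebraic
intersection of closed curves is defined by Poincaré duality: the one-form `η` is dual to `β` if
`∫_β φ = ∫_X η ∧ φ` for all closed `φ`, and `Int(α, β) = ∫_α η`. -/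

/-- A closed one-form, constant on each triangle: a real covector for each triangle, such that the
covectors on the two sides of an edge agree on the vectors tangent to the edge. -/
structure ClosedForm where
  cov : X.T → ℂ →ₗ[ℝ] ℝ
  compat : ∀ e : X.T × Fin 3, cov e.1 (X.side e) = cov (X.glue e).1 (X.side e)

variable {X}

/-- `∫_X φ ∧ ψ`. -/
def ClosedForm.wedge (φ ψ : X.ClosedForm) : ℝ :=
  ∑ t, X.area t *
    (φ.cov t 1 * ψ.cov t Complex.I - φ.cov t Complex.I * ψ.cov t 1)

/-- `∫_γ φ = r`, the integral of the closed form `φ` along `γ` being the increment of a primitive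
`F` of `φ` along `γ`. -/
def ClosedForm.HasIntegral (φ : X.ClosedForm) (γ : X.ClosedCurve) (r : ℝ) : Prop :=
  ∃ F : ℝ → ℝ, (∀ s ∈ Icc (0 : ℝ) 1, ∀ᶠ s' in 𝓝[Icc (0 : ℝ) 1] s,
      ∃ t, X.Joins t (γ.toFun s) (γ.toFun s') (γ.dev s' - γ.dev s) ∧
        F s' - F s = φ.cov t (γ.dev s' - γ.dev s)) ∧
    F 1 - F 0 = r

/-- The closed form `η` is Poincaré dual to the closed curve `β`. -/
def ClosedForm.IsDual (η : X.ClosedForm) (β : X.ClosedCurve) : Prop :=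
  ∀ φ : X.ClosedForm, φ.HasIntegral β (η.wedge φ)

/-- `Int(α, β) = k`. -/
def ClosedCurve.HasInt (α β : X.ClosedCurve) (k : ℝ) : Prop :=
  ∃ η : X.ClosedForm, η.IsDual β ∧ η.HasIntegral α k

variable (X)

/-- `KVol(X) = Vol(X) · sup Int(α, β) / (l(α) l(β))`, the supremum over all pairs of piecewise smooth
closed curves. (Constant curves contribute `0 / 0 = 0`.) -/
def KVol : ℝ≥0∞ :=
  ENNReal.ofReal X.vol * ⨆ (α : X.ClosedCurve) (β : X.ClosedCurve) (k : ℝ) (_ : α.HasInt β k),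
    ENNReal.ofReal k / (α.length * β.length)

/-- `K(S)`, the infimum of `KVol` over a set `S` of translation surfaces. -/
def infKVol (S : Set TranslationSurface) : ℝ≥0∞ := ⨅ X ∈ S, X.KVol

/-! ### Surfaces glued from rectangles, and the staircase surfaces -/

/-- The gluing of the triangles of a surface made of rectangles, each cut along the diagonal from
its lower left to its upper right corner. The triangle `(b, false)` below the diagonal has sides
`0` = bottom, `1` = right, `2` = diagonal; the triangle `(b, true)` above it has sides
`0` = diagonal, `1` = top, `2` = left. -/
def rectGlue {B : Type} (right up : Equiv.Perm B) :
    (B × Bool) × Fin 3 → (B × Bool) × Fin 3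
  | ((b, false), 0) => ((up.symm b, true), 1)
  | ((b, false), 1) => ((right b, true), 2)
  | ((b, false), 2) => ((b, true), 0)
  | ((b, true), 0) => ((b, false), 2)
  | ((b, true), 1) => ((up b, false), 0)
  | ((b, true), 2) => ((right.symm b, false), 1)

/-- The vertices of the two triangles of a `w × h` rectangle. -/
def rectVert (w h : ℝ) : Bool → Fin 3 → ℂ
  | false => ![0, ⟨w, 0⟩, ⟨w, h⟩]
  | true => ![0, ⟨w, h⟩, ⟨0, h⟩]

/-- The translation surface made of rectangles `b` of width `w b` and height `h b`: the right side of
`b` is glued to the left side of `right b`, and the top of `b` to the bottom of `up b`. -/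
def ofRectangles (B : Type) [Fintype B] (w h : B → ℝ) (hw : ∀ b, 0 < w b) (hh : ∀ b, 0 < h b)
    (right up : Equiv.Perm B) (hr : ∀ b, h (right b) = h b) (hu : ∀ b, w (up b) = w b) :
    TranslationSurface where
  T := B × Bool
  vert t := rectVert (w t.1) (h t.1) t.2
  glue := rectGlue right up
  orientation_pos := by
    rintro ⟨b, _ | _⟩ <;> simp [rectVert] <;> exact mul_pos (hw b) (hh b)
  glue_glue := by
    rintro ⟨⟨b, _ | _⟩, i⟩ <;> fin_cases i <;> simp [rectGlue]
  glue_vert := by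
    have hr' : ∀ b, h (right.symm b) = h b := fun b => by
      rw [← hr (right.symm b), Equiv.apply_symm_apply]
    have hu' : ∀ b, w (up.symm b) = w b := fun b => by
      rw [← hu (up.symm b), Equiv.apply_symm_apply]
    rintro ⟨⟨b, _ | _⟩, i⟩ <;> fin_cases i <;>
      simp [rectGlue, rectVert, Complex.ext_iff, hr, hu, hr', hu']

/-- The staircase with `g` steps consists of `2g - 1` rectangles `R₁, C₁, R₂, C₂, …, C_{g-1}, R_g`,
numbered `0, …, 2g - 2` here: the corner squares `C_i` have odd numbers, the `R_i` with `i` odd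
(standing upright) have numbers `≡ 0`, those with `i` even (lying) numbers `≡ 2` mod `4`.
The horizontal cylinders are formed, from left to right, by the rectangles
`4m + 1, 4m + 2, 4m + 3` (without the last one if it does not exist), and by `4m` alone. -/
def stairRight (g : ℕ) : Equiv.Perm (Fin (2 * g - 1)) where
  toFun k := ⟨if k.1 % 4 = 0 then k.1 else if k.1 % 4 = 3 then k.1 - 2 else
    if k.1 + 1 < 2 * g - 1 then k.1 + 1 else k.1 - 1, by have := k.2; grind⟩
  invFun k := ⟨if k.1 % 4 = 0 then k.1 else if k.1 % 4 = 1 then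
    (if k.1 + 2 < 2 * g - 1 then k.1 + 2 else k.1 + 1) else k.1 - 1, by have := k.2; grind⟩
  left_inv k := by have := k.2; ext; grind
  right_inv k := by have := k.2; ext; grind

/-- The vertical cylinders of the staircase are formed, from top to bottom, by the rectangles
`4m - 1, 4m, 4m + 1` (without those that do not exist), and by `4m + 2` alone. -/
def stairDown (g : ℕ) : Equiv.Perm (Fin (2 * g - 1)) where
  toFun k := ⟨if k.1 % 4 = 2 then k.1 else if k.1 % 4 = 1 then k.1 - 2 else
    if k.1 + 1 < 2 * g - 1 then k.1 + 1 else k.1 - 1, by have := k.2; grind⟩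
  invFun k := ⟨if k.1 % 4 = 2 then k.1 else if k.1 % 4 = 3 then
    (if k.1 + 2 < 2 * g - 1 then k.1 + 2 else k.1 + 1) else if k.1 = 0 then
    (if 1 < 2 * g - 1 then 1 else 0) else k.1 - 1, by have := k.2; grind⟩
  left_inv k := by have := k.2; ext; grind
  right_inv k := by have := k.2; ext; grind

/-- The width of the rectangle number `k` of the staircase with steps of size `n`. -/
def stairWidth (n : ℕ+) (k : ℕ) : ℝ := if k % 4 = 2 then (n : ℕ) else 1

/-- The height of the rectangle number `k` of the staircase with steps of size `n`. -/
def stairHeight (n : ℕ+) (k : ℕ) : ℝ := if k % 4 = 0 then (n : ℕ) else 1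

/-- The staircase surface `L_g^n`, with steps of length and height `n`. -/
def staircase (g : ℕ) (n : ℕ+) : TranslationSurface :=
  ofRectangles (Fin (2 * g - 1)) (fun k => stairWidth n k) (fun k => stairHeight n k)
    (fun k => by simp only [stairWidth]; split_ifs <;> simp)
    (fun k => by simp only [stairHeight]; split_ifs <;> simp)
    (stairRight g) (stairDown g).symm
    (fun k => by
      have := k.2
      simp only [stairHeight, stairRight, Equiv.coe_fn_mk]
      grind)
    (fun k => by
      have := k.2
      simp only [stairWidth, stairDown, Equiv.coe_fn_symm_mk]
      grind)

end TranslationSurface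

end

/-! On the staircase, `KVol` equals area divided by `n`; the limit `g` and the bound on the infimum
follow from this value.

Upper bound. Let `η` be dual to `β`. Then `Int(α, β) = ∫_α η` is at most the comass of `η` times the
length of `α`, so it suffices that the comass of `η` is at most `l(β) / n` (`IsDual.enorm_cov_le`).
A closed form on the staircase is `p dx + q dy`, with `p` and `q` constant on rectangles, `p` on
vertical and `q` on horizontal cylinders (`cov_true_eq_cov_false`). The value of `q` at a rectangle
is the integral over the surface of `q P`, where `P` is constant on vertical cylinders and `|P| ≤ 1
/ n`; similarly for `p` with a weight `Q`. So each value `η(v)` is `∫ η ∧ φ = ∫_β φ` for a closed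
form `φ` of comass at most `|v| / n`, hence at most `|v| l(β) / n`.

The weights exist because every cylinder contains a rectangle of area `n`. If that rectangle forms a
cylinder by itself in the other direction, `1 / n` on it suffices. Otherwise `1 / n` must be put on
its whole crossing cylinder, which also charges the adjacent unit squares; weight `-1 / n ^ 2` on
the next long rectangles cancels this (`sum_mul_stairWeight`).

Lower bound. The bottom side and the right side of the first rectangle are closed curves of lengths
`1` and `n`, since there is only one vertex, and they intersect once. -/

noncomputable section

namespace TranslationSurface

/-! ### Lengths and integrals of closed forms -/

/-- If the increments of `f` are locally bounded by the mass that `μ` gives to intervals, they are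
so bounded globally. -/
theorem enorm_sub_le_measure_Ioc {E : Type*} [NormedAddCommGroup E] (μ : Measure ℝ)
    {f : ℝ → E} {a b : ℝ} (hab : a ≤ b)
    (hf : ∀ s ∈ Icc a b, ∀ᶠ s' in 𝓝[Icc a b] s,
      ‖f s' - f s‖ₑ ≤ μ (Ioc (min s s') (max s s'))) :
    ‖f b - f a‖ₑ ≤ μ (Ioc a b) := by
  -- Continuous induction: the supremum of the endpoints for which the bound holds is itself such an
  -- endpoint, and if it were less than `b` it could be moved to the right. Half-open intervals make
  -- the bounds add up.
  set S : Set ℝ := {s ∈ Icc a b | ‖f s - f a‖ₑ ≤ μ (Ioc a s)} with hS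
  have haS : a ∈ S := ⟨left_mem_Icc.2 hab, by simp⟩
  have hbdd : BddAbove S := ⟨b, fun s hs => hs.1.2⟩
  set c := sSup S with hc
  have hac : a ≤ c := le_csSup hbdd haS
  have hcb : c ≤ b := csSup_le ⟨a, haS⟩ fun s hs => hs.1.2
  have step : ∀ s s', a ≤ s → s ≤ s' → ‖f s - f a‖ₑ ≤ μ (Ioc a s) →
      ‖f s' - f s‖ₑ ≤ μ (Ioc s s') → ‖f s' - f a‖ₑ ≤ μ (Ioc a s') := by
    intro s s' has hss h1 h2
    rw [← Ioc_union_Ioc_eq_Ioc has hss,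
      measure_union (Ioc_disjoint_Ioc_of_le le_rfl) measurableSet_Ioc, add_comm]
    calc ‖f s' - f a‖ₑ = ‖(f s' - f s) + (f s - f a)‖ₑ := by rw [sub_add_sub_cancel]
      _ ≤ _ := (enorm_add_le _ _).trans (add_le_add h2 h1)
  obtain ⟨ε, hε, hloc⟩ := Metric.mem_nhdsWithin_iff.1 (hf c ⟨hac, hcb⟩)
  have hcS : c ∈ S := by
    obtain ⟨s, hs, hcs⟩ := exists_lt_of_lt_csSup ⟨a, haS⟩ (show c - ε < sSup S by linarith)
    have hsc : s ≤ c := le_csSup hbdd hs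
    have h := hloc ⟨by rw [Metric.mem_ball, Real.dist_eq, abs_lt]; constructor <;> linarith, hs.1⟩
    rw [mem_ofPred_eq, min_eq_right hsc, max_eq_left hsc] at h
    refine ⟨⟨hac, hcb⟩, step s c hs.1.1 hsc hs.2 ?_⟩
    rwa [← edist_eq_enorm_sub, edist_comm, edist_eq_enorm_sub]
  rcases hcb.eq_or_lt with h | h
  · exact h ▸ hcS.2
  · set s := min b (c + ε / 2) with hs
    have hcs : c < s := lt_min h (by linarith)
    have hsb : s ≤ b := min_le_left _ _
    have hs2 : s ≤ c + ε / 2 := min_le_right _ _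
    have h := hloc (show s ∈ _ from ⟨by
      rw [Metric.mem_ball, Real.dist_eq, abs_lt]; constructor <;> linarith, by linarith, hsb⟩)
    rw [mem_ofPred_eq, min_eq_left hcs.le, max_eq_right hcs.le] at h
    have : s ∈ S := ⟨⟨by linarith, hsb⟩, step c s hac hcs.le hcS.2 h⟩
    exact absurd (le_csSup hbdd this) (not_le.2 hcs)

/-- A displacement is at most as long as the path. -/
theorem enorm_sub_le_lintegral_enorm_deriv {f : ℝ → ℂ} {a b : ℝ} (hab : a ≤ b)
    (hf : ContDiffOn ℝ ∞ f (Icc a b)) : ‖f b - f a‖ₑ ≤ ∫⁻ s in Ioc a b, ‖deriv f s‖ₑ := by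
  rw [← intervalIntegral.integral_deriv_of_contDiffOn_Icc (hf.of_le (by norm_cast)) hab,
    intervalIntegral.integral_of_le hab]
  exact enorm_integral_le_lintegral_enorm _

variable {X : TranslationSurface}

/-- The integral of a closed form of comass at most `m` is at most `m` times the length. -/
theorem ClosedForm.HasIntegral.enorm_le {φ : X.ClosedForm} {γ : X.ClosedCurve} {r : ℝ}
    (h : φ.HasIntegral γ r) {m : ℝ≥0∞} (hm : ∀ t v, ‖φ.cov t v‖ₑ ≤ m * ‖v‖ₑ) :
    ‖r‖ₑ ≤ m * γ.length := by
  obtain ⟨F, hF, rfl⟩ := h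
  obtain ⟨N, s, hmono, h0, h1, hsm⟩ := γ.piecewise_smooth
  have hmem : ∀ k, s k ∈ Icc (0 : ℝ) 1 := fun k =>
    ⟨h0 ▸ hmono.monotone (Fin.zero_le k), h1 ▸ hmono.monotone (Fin.le_last k)⟩
  -- `m` times arc length. Since `dev` is smooth only piecewise, the local bound is made global on
  -- each piece and the pieces are then added.
  set μ : Measure ℝ := m • (volume.withDensity fun s => ‖deriv γ.dev s‖ₑ) with hμ
  have hμI : ∀ a b : ℝ, μ (Ioc a b) = m * ∫⁻ s in Ioc a b, ‖deriv γ.dev s‖ₑ := fun a b => by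
    rw [hμ, Measure.smul_apply, withDensity_apply _ measurableSet_Ioc, smul_eq_mul]
  have piece : ∀ k : Fin N, ‖F (s k.succ) - F (s k.castSucc)‖ₑ ≤
      μ (Ioc (s k.castSucc) (s k.succ)) := by
    intro k
    have hk : s k.castSucc ≤ s k.succ := hmono.monotone k.castSucc_lt_succ.le
    have hsub : Icc (s k.castSucc) (s k.succ) ⊆ Icc 0 1 := Icc_subset_Icc (hmem _).1 (hmem _).2
    refine enorm_sub_le_measure_Ioc μ hk fun u hu => ?_
    filter_upwards [nhdsWithin_mono u hsub (hF u (hsub hu)), self_mem_nhdsWithin]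
      with u' ⟨t, _, ht⟩ hu'
    rw [ht, hμI]
    refine (hm t _).trans ?_
    gcongr
    rcases le_total u u' with hle | hle
    · rw [min_eq_left hle, max_eq_right hle]
      exact enorm_sub_le_lintegral_enorm_deriv hle ((hsm k).mono (Icc_subset_Icc hu.1 hu'.2))
    · rw [min_eq_right hle, max_eq_left hle, ← edist_eq_enorm_sub, edist_comm, edist_eq_enorm_sub]
      exact enorm_sub_le_lintegral_enorm_deriv hle ((hsm k).mono (Icc_subset_Icc hu'.1 hu.2))
  have total : ∀ k, ‖F (s k) - F (s 0)‖ₑ ≤ μ (Ioc (s 0) (s k)) := by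
    intro k
    induction k using Fin.induction with
    | zero => simp
    | succ k ih =>
      rw [← Ioc_union_Ioc_eq_Ioc (hmono.monotone (Fin.zero_le k.castSucc))
        (hmono.monotone k.castSucc_lt_succ.le),
        measure_union (Ioc_disjoint_Ioc_of_le le_rfl) measurableSet_Ioc,
        add_comm (μ _), ← sub_add_sub_cancel (F (s k.succ)) (F (s k.castSucc))]
      exact (enorm_add_le _ _).trans (add_le_add (piece k) ih)
  have := total (Fin.last N)
  rw [h0, h1, hμI] at this
  refine this.trans ?_
  unfold ClosedCurve.length
  gcongr
  exact Ioc_subset_Icc_self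

/-! ### Vertices and edges -/

theorem vert_mem_triangle (t : X.T) (i : Fin 3) : X.vert t i ∈ X.triangle t :=
  subset_convexHull ℝ _ (mem_range_self i)

theorem edge_mem_triangle (e : X.T × Fin 3) {u : ℝ} (hu : u ∈ Icc (0 : ℝ) 1) :
    X.vert e.1 e.2 + u * X.side e ∈ X.triangle e.1 := by
  have := (convex_convexHull ℝ (range (X.vert e.1))).add_smul_sub_mem
    (X.vert_mem_triangle e.1 e.2) (X.vert_mem_triangle e.1 (e.2 + 1)) hu
  simpa [side, triangle] using this

/-- Corners at the same vertex give the same point of the surface. -/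
theorem SameVertex.pt_eq {c c' : X.T × Fin 3} (h : X.SameVertex c c') :
    X.pt c.1 (X.vert c.1 c.2) (X.vert_mem_triangle _ _) =
      X.pt c'.1 (X.vert c'.1 c'.2) (X.vert_mem_triangle _ _) := by
  induction h with
  | refl c => rfl
  | symm c c' _ ih => exact ih.symm
  | trans a b c _ _ h1 h2 => exact h1.trans h2
  | rel c c' h =>
    subst h
    have h3 : c.2 + 2 + 1 = c.2 := by
      rw [add_assoc]; exact add_eq_left.2 rfl
    -- Parameter `1` is the end of side `c.2 + 2`, that is the vertex `c.2`; the gluing reverses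
    -- sides, so it is matched with the start of the glued side.
    refine Quot.sound ⟨c.2 + 2, 1, ⟨zero_le_one, le_rfl⟩, ?_, rfl, ?_⟩
    · simp [side, h3]
    · have := X.glue_vert (c.1, c.2 + 2)
      simp only [side, Complex.ofReal_one, one_mul]
      linear_combination -this

variable (X) in
/-- The closed curve that runs along an edge with coinciding end points. -/
def edgeLoop (e : X.T × Fin 3) (h : X.SameVertex e (e.1, e.2 + 1)) : X.ClosedCurve where
  toFun s := X.pt e.1 (X.vert e.1 e.2 + (projIcc (0 : ℝ) 1 zero_le_one s : ℝ) * X.side e)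
    (X.edge_mem_triangle e (projIcc (0 : ℝ) 1 zero_le_one s).2)
  dev s := s * X.side e
  closed := by
    simpa [side] using h.pt_eq
  piecewise_smooth := by
    refine ⟨1, fun k => (k : ℝ), fun a b hab => Nat.cast_lt.2 hab, by simp, by simp,
      fun k => ContDiff.contDiffOn ?_⟩
    exact Complex.ofRealCLM.contDiff.mul contDiff_const
  develops := by
    intro s hs
    filter_upwards [self_mem_nhdsWithin] with s' hs'
    refine ⟨e.1, _, _, X.edge_mem_triangle e hs, X.edge_mem_triangle e hs', ?_, ?_, by ring⟩
    · simp [projIcc_of_mem _ hs]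
    · simp [projIcc_of_mem _ hs']

theorem length_edgeLoop (e : X.T × Fin 3) (h : X.SameVertex e (e.1, e.2 + 1)) :
    (X.edgeLoop e h).length = ‖X.side e‖ₑ := by
  have : ∀ s : ℝ, deriv (X.edgeLoop e h).dev s = X.side e := fun s => by
    have := ((Complex.ofRealCLM.hasDerivAt (x := s)).mul_const (X.side e)).deriv
    rwa [Complex.ofRealCLM_apply, Complex.ofReal_one, one_mul] at this
  simp [ClosedCurve.length, this]

theorem hasIntegral_edgeLoop (φ : X.ClosedForm) (e : X.T × Fin 3)
    (h : X.SameVertex e (e.1, e.2 + 1)) :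
    φ.HasIntegral (X.edgeLoop e h) (φ.cov e.1 (X.side e)) := by
  refine ⟨fun s => s * φ.cov e.1 (X.side e), fun s hs => ?_, by simp⟩
  filter_upwards [self_mem_nhdsWithin] with s' hs'
  refine ⟨e.1, ⟨_, _, X.edge_mem_triangle e hs, X.edge_mem_triangle e hs', ?_, ?_, ?_⟩, ?_⟩
  · simp [edgeLoop, projIcc_of_mem _ hs]
  · simp [edgeLoop, projIcc_of_mem _ hs']
  · simp only [edgeLoop]; ring
  · have : (X.edgeLoop e h).dev s' - (X.edgeLoop e h).dev s = (s' - s) • X.side e := by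
      simp [edgeLoop, sub_mul]
    rw [this, map_smul, smul_eq_mul, sub_mul]

/-- The angles of a triangle add up to `π`. -/
theorem sum_cornerAngle (t : X.T) : ∑ i, X.cornerAngle (t, i) = Real.pi := by
  have hne : X.vert t 1 ≠ X.vert t 0 := fun h => by
    have := X.orientation_pos t
    simp [h] at this
  have := EuclideanGeometry.angle_add_angle_add_angle_eq_pi (X.vert t 2) hne
  rw [Fin.sum_univ_three]
  simp only [cornerAngle]
  rw [← this]
  simp only [Fin.isValue, zero_add, show (1 : Fin 3) + 1 = 2 from rfl,
    show (1 : Fin 3) + 2 = 0 from rfl, show (2 : Fin 3) + 1 = 0 from rfl,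
    show (2 : Fin 3) + 2 = 1 from rfl]
  rw [EuclideanGeometry.angle_comm (X.vert t 1) (X.vert t 0),
    EuclideanGeometry.angle_comm (X.vert t 2) (X.vert t 1),
    EuclideanGeometry.angle_comm (X.vert t 0) (X.vert t 2)]
  ring

/-- If there is only one vertex, its angle is `π` times the number of triangles. -/
theorem coneAngle_of_forall_sameVertex {c : X.T × Fin 3} (h : ∀ c', X.SameVertex c c') :
    X.coneAngle c = Fintype.card X.T * Real.pi := by
  classical
  rw [coneAngle, Finset.filter_true_of_mem fun c' _ => h c', Fintype.sum_prod_type]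
  simp [sum_cornerAngle]

/-! ### Surfaces made of rectangles -/

section Rectangles

variable {B : Type} [Fintype B] {w h : B → ℝ} {hw : ∀ b, 0 < w b} {hh : ∀ b, 0 < h b}
  {right up : Equiv.Perm B} {hr : ∀ b, h (right b) = h b} {hu : ∀ b, w (up b) = w b}

theorem area_ofRectangles (b : B) (i : Bool) :
    (ofRectangles B w h hw hh right up hr hu).area (b, i) = w b * h b / 2 := by
  cases i <;> simp [area, ofRectangles, rectVert]

theorem vol_ofRectangles :
    (ofRectangles B w h hw hh right up hr hu).vol = ∑ b, w b * h b := by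
  rw [vol]
  refine (Fintype.sum_prod_type _).trans (Finset.sum_congr rfl fun b _ => ?_)
  rw [Fintype.sum_bool, area_ofRectangles, area_ofRectangles, add_halves]

theorem side_bottom (b : B) :
    (ofRectangles B w h hw hh right up hr hu).side ((b, false), 0) = w b • (1 : ℂ) := by
  simp [side, ofRectangles, rectVert, Complex.ext_iff]

theorem side_right (b : B) :
    (ofRectangles B w h hw hh right up hr hu).side ((b, false), 1) = h b • Complex.I := by
  simp [side, ofRectangles, rectVert, Complex.ext_iff]

theorem side_diagonal (b : B) :
    (ofRectangles B w h hw hh right up hr hu).side ((b, false), 2)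
      = -(w b • (1 : ℂ) + h b • Complex.I) := by
  simp [side, ofRectangles, rectVert, Complex.ext_iff]

variable (φ : (ofRectangles B w h hw hh right up hr hu).ClosedForm)

theorem ClosedForm.cov_up_one (b : B) : φ.cov (up b, false) 1 = φ.cov (b, true) 1 := by
  have h1 := φ.compat ((up b, false), 0)
  have h2 : (ofRectangles B w h hw hh right up hr hu).glue ((up b, false), 0) = ((b, true), 1) := by
    simp [ofRectangles, rectGlue]
  rw [h2, side_bottom, map_smul, map_smul] at h1
  exact mul_left_cancel₀ (hw _).ne' h1

theorem ClosedForm.cov_right_I (b : B) :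
    φ.cov (right b, true) Complex.I = φ.cov (b, false) Complex.I := by
  have h1 := φ.compat ((b, false), 1)
  have h2 : (ofRectangles B w h hw hh right up hr hu).glue ((b, false), 1)
      = ((right b, true), 2) := rfl
  rw [h2, side_right, map_smul, map_smul] at h1
  exact (mul_left_cancel₀ (hh _).ne' h1).symm

theorem ClosedForm.cov_diagonal (b : B) :
    w b * φ.cov (b, false) 1 + h b * φ.cov (b, false) Complex.I
      = w b * φ.cov (b, true) 1 + h b * φ.cov (b, true) Complex.I := by
  have h1 := φ.compat ((b, false), 2)
  have h2 : (ofRectangles B w h hw hh right up hr hu).glue ((b, false), 2) = ((b, true), 0) := rfl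
  rw [h2, side_diagonal] at h1
  simpa only [map_neg, map_add, map_smul, smul_eq_mul, neg_inj] using h1

/-- The covectors of the two triangles agree on the diagonal, which has nonzero components in both
directions; agreement in one more direction makes them equal. -/
theorem ClosedForm.cov_one_iff_cov_I (b : B) :
    φ.cov (b, false) 1 = φ.cov (b, true) 1 ↔
      φ.cov (b, false) Complex.I = φ.cov (b, true) Complex.I := by
  have h1 := φ.cov_diagonal b
  constructor <;> intro h2 <;> rw [h2] at h1
  · exact mul_left_cancel₀ (hh b).ne' (add_left_cancel h1)
  · exact mul_left_cancel₀ (hw b).ne' (add_right_cancel h1)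

/-- The closed form `P dx + Q dy`, with `P` and `Q` constant on each rectangle, `P` constant on
vertical and `Q` on horizontal cylinders. -/
def rectForm (P Q : B → ℝ) (hP : ∀ b, P (up b) = P b) (hQ : ∀ b, Q (right b) = Q b) :
    (ofRectangles B w h hw hh right up hr hu).ClosedForm where
  cov t := P t.1 • Complex.reLm + Q t.1 • Complex.imLm
  compat := by
    have hP' : ∀ b, P (up.symm b) = P b := fun b => by rw [← hP, Equiv.apply_symm_apply]
    have hQ' : ∀ b, Q (right.symm b) = Q b := fun b => by rw [← hQ, Equiv.apply_symm_apply]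
    rintro ⟨⟨b, _ | _⟩, i⟩ <;> fin_cases i <;>
      simp [ofRectangles, rectGlue, rectVert, side, hP, hQ, hP', hQ']

variable {P Q : B → ℝ} {hP : ∀ b, P (up b) = P b} {hQ : ∀ b, Q (right b) = Q b}

theorem rectForm_cov (b : B) (i : Bool) (v : ℂ) :
    (rectForm P Q hP hQ : (ofRectangles B w h hw hh right up hr hu).ClosedForm).cov (b, i) v
      = P b * v.re + Q b * v.im := rfl

theorem enorm_rectForm_cov_le {M : ℝ} (hM : 0 ≤ M) (hPQ : ∀ b, P b ^ 2 + Q b ^ 2 ≤ M ^ 2)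
    (t : B × Bool) (v : ℂ) :
    ‖(rectForm P Q hP hQ : (ofRectangles B w h hw hh right up hr hu).ClosedForm).cov t v‖ₑ
      ≤ ENNReal.ofReal M * ‖v‖ₑ := by
  obtain ⟨b, i⟩ := t
  rw [rectForm_cov, ← ofReal_norm v, ← ENNReal.ofReal_mul hM, Real.enorm_eq_ofReal_abs]
  refine ENNReal.ofReal_le_ofReal (abs_le_of_sq_le_sq ?_ (by positivity))
  rw [mul_pow, Complex.sq_norm, Complex.normSq_apply]
  -- Cauchy-Schwarz, through Lagrange's identity.
  nlinarith [hPQ b, sq_nonneg (P b * v.im - Q b * v.re), sq_nonneg v.re, sq_nonneg v.im]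

/-- A closed form that agrees on the two triangles of each rectangle, paired with `P dx + Q dy`. -/
theorem ClosedForm.wedge_rectForm
    (hφ : ∀ b, φ.cov (b, true) 1 = φ.cov (b, false) 1 ∧
      φ.cov (b, true) Complex.I = φ.cov (b, false) Complex.I) :
    φ.wedge (rectForm P Q hP hQ) = ∑ b, w b * h b *
      (φ.cov (b, false) 1 * Q b - φ.cov (b, false) Complex.I * P b) := by
  rw [wedge]
  refine (Fintype.sum_prod_type _).trans (Finset.sum_congr rfl fun b _ => ?_)
  rw [Fintype.sum_bool, area_ofRectangles, area_ofRectangles]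
  simp only [rectForm_cov, (hφ b).1, (hφ b).2, Complex.one_re, Complex.one_im, Complex.I_re,
    Complex.I_im]
  ring

end Rectangles

theorem ClosedForm.wedge_comm (φ ψ : X.ClosedForm) : φ.wedge ψ = -ψ.wedge φ := by
  rw [wedge, wedge, ← Finset.sum_neg_distrib]
  exact Finset.sum_congr rfl fun t _ => by ring

/-! ### Vertices of surfaces made of rectangles -/

theorem SameVertex.symm {X : TranslationSurface} {c c' : X.T × Fin 3} (h : X.SameVertex c c') :
    X.SameVertex c' c := Relation.EqvGen.symm _ _ h

theorem SameVertex.trans {X : TranslationSurface} {c c' c'' : X.T × Fin 3}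
    (h : X.SameVertex c c') (h' : X.SameVertex c' c'') : X.SameVertex c c'' :=
  Relation.EqvGen.trans _ _ _ h h'

section Rectangles

variable {B : Type} [Fintype B] {w h : B → ℝ} {hw : ∀ b, 0 < w b} {hh : ∀ b, 0 < h b}
  {right up : Equiv.Perm B} {hr : ∀ b, h (right b) = h b} {hu : ∀ b, w (up b) = w b}

theorem sameVertex_of_rectGlue {c c' : (B × Bool) × Fin 3}
    (hc : c' = rectGlue right up (c.1, c.2 + 2)) :
    (ofRectangles B w h hw hh right up hr hu).SameVertex c c' :=
  Relation.EqvGen.rel _ _ hc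

/-- The upper right corner of a rectangle is the lower left corner of the rectangle reached by going
right and then up. -/
theorem sameVertex_up_right (b : B) :
    (ofRectangles B w h hw hh right up hr hu).SameVertex ((b, false), 2)
      ((up (right b), false), 0) :=
  SameVertex.trans (c' := ((right b, true), 2)) (sameVertex_of_rectGlue rfl)
    (sameVertex_of_rectGlue rfl)

theorem sameVertex_right (b : B) :
    (ofRectangles B w h hw hh right up hr hu).SameVertex ((b, false), 1)
      ((right b, false), 0) := by
  refine SameVertex.symm (SameVertex.trans (c' := ((right b, true), 0))
    (sameVertex_of_rectGlue rfl) (sameVertex_of_rectGlue ?_))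
  change _ = ((right.symm (right b), false), 1)
  rw [Equiv.symm_apply_apply]
  rfl

/-- The upper right corner of a rectangle is the lower left corner of the rectangle reached by going
up and then right. -/
theorem sameVertex_right_up (b : B) :
    (ofRectangles B w h hw hh right up hr hu).SameVertex ((b, false), 2)
      ((right (up b), false), 0) := by
  refine SameVertex.trans (c' := ((up b, false), 1)) ?_ (sameVertex_right _)
  refine SameVertex.symm (SameVertex.trans (c' := ((b, true), 1))
    (sameVertex_of_rectGlue ?_) (sameVertex_of_rectGlue rfl))
  change _ = ((up.symm (up b), true), 1)
  rw [Equiv.symm_apply_apply]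
  rfl

/-- If all lower left corners coincide, there is only one vertex. -/
theorem sameVertex_of_lowerLeft (c₀ : (B × Bool) × Fin 3)
    (hc : ∀ b, (ofRectangles B w h hw hh right up hr hu).SameVertex c₀ ((b, false), 0))
    (c : (B × Bool) × Fin 3) : (ofRectangles B w h hw hh right up hr hu).SameVertex c₀ c := by
  obtain ⟨⟨b, _ | _⟩, i⟩ := c <;> fin_cases i
  · exact hc b
  · exact (hc _).trans (sameVertex_right b).symm
  · exact (hc _).trans (sameVertex_right_up b).symm
  · exact (hc b).trans (sameVertex_of_rectGlue rfl)
  · exact (hc _).trans ((sameVertex_right_up b).symm.trans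
      (SameVertex.symm (sameVertex_of_rectGlue rfl)))
  · exact (hc (up b)).trans (SameVertex.symm (sameVertex_of_rectGlue rfl))

end Rectangles

/-! ### The combinatorics of the staircase -/

section Staircase

variable {g : ℕ} {n : ℕ+}

/-- The rectangle above a given one. -/
abbrev stairUp (g : ℕ) : Equiv.Perm (Fin (2 * g - 1)) := (stairDown g).symm

theorem stairUp_eq_iff {a b : Fin (2 * g - 1)} : stairUp g a = b ↔ a = stairDown g b :=
  Equiv.symm_apply_eq _

theorem stairRight_self {k : Fin (2 * g - 1)} (hk : k.1 % 4 = 0) : stairRight g k = k := by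
  ext; simp [stairRight, hk]

theorem stairRight_succ {k l : Fin (2 * g - 1)} (hk : k.1 % 4 = 1 ∨ k.1 % 4 = 2)
    (hl : l.1 = k.1 + 1) : stairRight g k = l := by
  ext; have := l.2; simp only [stairRight, Equiv.coe_fn_mk]; grind

theorem stairRight_pred_pred {k l : Fin (2 * g - 1)} (hk : k.1 % 4 = 3)
    (hl : k.1 = l.1 + 2) : stairRight g k = l := by
  ext; simp only [stairRight, Equiv.coe_fn_mk]; grind

theorem stairUp_self {k : Fin (2 * g - 1)} (hk : k.1 % 4 = 2) : stairUp g k = k := by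
  rw [stairUp_eq_iff]; ext; simp [stairDown, hk]

theorem stairUp_pred {k l : Fin (2 * g - 1)} (hk : k.1 % 4 = 0 ∨ k.1 % 4 = 1)
    (hl : k.1 = l.1 + 1) : stairUp g k = l := by
  rw [stairUp_eq_iff]
  ext; have := k.2; simp only [stairDown, Equiv.coe_fn_mk]; grind

theorem stairUp_add_two {k l : Fin (2 * g - 1)} (hk : k.1 % 4 = 3)
    (hl : l.1 = k.1 + 2) : stairUp g k = l := by
  rw [stairUp_eq_iff]
  ext; simp only [stairDown, Equiv.coe_fn_mk]; grind

theorem stairUp_succ {k l : Fin (2 * g - 1)} (hk : k.1 % 4 = 3) (hg : 2 * g - 1 ≤ k.1 + 2)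
    (hl : l.1 = k.1 + 1) : stairUp g k = l := by
  rw [stairUp_eq_iff]
  ext; simp only [stairDown, Equiv.coe_fn_mk]; grind

theorem stairUp_zero {k l : Fin (2 * g - 1)} (hk : k.1 = 0) (hl : l.1 = 1) :
    stairUp g k = l := by
  rw [stairUp_eq_iff]
  ext; simp only [stairDown, Equiv.coe_fn_mk]; grind

/-! ### Connectedness, the single vertex and the cone angle -/

theorem staircase_isConnected (g : ℕ) (n : ℕ+) : (staircase g n).IsConnected := by
  have diag : ∀ b : Fin (2 * g - 1), Relation.EqvGen
      (fun a b => ∃ i, ((staircase g n).glue (a, i)).1 = b) (b, false) (b, true) :=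
    fun b => Relation.EqvGen.rel _ _ ⟨2, rfl⟩
  have right : ∀ b : Fin (2 * g - 1), Relation.EqvGen
      (fun a b => ∃ i, ((staircase g n).glue (a, i)).1 = b) (b, false) (stairRight g b, true) :=
    fun b => Relation.EqvGen.rel _ _ ⟨1, rfl⟩
  have up : ∀ b : Fin (2 * g - 1), Relation.EqvGen
      (fun a b => ∃ i, ((staircase g n).glue (a, i)).1 = b) (b, true) (stairUp g b, false) :=
    fun b => Relation.EqvGen.rel _ _ ⟨1, rfl⟩
  have key : ∀ (k : ℕ) (hk : k < 2 * g - 1), Relation.EqvGen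
      (fun a b => ∃ i, ((staircase g n).glue (a, i)).1 = b)
      ((⟨0, by omega⟩, false) : Fin (2 * g - 1) × Bool) (⟨k, hk⟩, false) := by
    intro k
    induction k with
    | zero => exact fun hk => Relation.EqvGen.refl _
    | succ k ih =>
      intro hk
      refine (ih (by omega)).trans _ _ _ ?_
      by_cases h : k % 4 = 1 ∨ k % 4 = 2
      · have := right ⟨k, by omega⟩
        rw [stairRight_succ (l := ⟨k + 1, hk⟩) h rfl] at this
        exact this.trans _ _ _ ((diag _).symm)
      · have := up ⟨k + 1, hk⟩
        rw [stairUp_pred (l := ⟨k, by omega⟩) (by simp only; omega) rfl] at this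
        exact ((diag _).trans _ _ _ this).symm
  have all : ∀ t : Fin (2 * g - 1) × Bool, Relation.EqvGen
      (fun a b => ∃ i, ((staircase g n).glue (a, i)).1 = b)
      ((⟨0, by have := t.1.2; omega⟩, false) : Fin (2 * g - 1) × Bool) t := by
    rintro ⟨b, _ | _⟩
    · exact key b.1 b.2
    · exact (key b.1 b.2).trans _ _ _ (diag b)
  exact fun t t' => (all t).symm.trans _ _ _ (all t')

/-- The staircase has only one vertex. -/
theorem staircase_sameVertex (hg : 2 ≤ g) (c : (Fin (2 * g - 1) × Bool) × Fin 3) :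
    (staircase g n).SameVertex ((⟨0, by omega⟩, false), 0) c := by
  refine sameVertex_of_lowerLeft _ ?_ c
  -- The upper right corner of `b` is reached both by right-then-up and by up-then-right, which
  -- identifies two lower left corners.
  have rel : ∀ {b r u k l : Fin (2 * g - 1)}, stairRight g b = r → stairUp g b = u →
      stairUp g r = k → stairRight g u = l →
      (staircase g n).SameVertex ((k, false), 0) ((l, false), 0) := by
    rintro b r u k l rfl rfl rfl rfl
    exact (sameVertex_up_right b).symm.trans (sameVertex_right_up b)
  have even : ∀ (k : ℕ) (hk : k + 2 < 2 * g - 1), k % 4 = 0 →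
      (staircase g n).SameVertex ((⟨k, by omega⟩, false), 0) ((⟨k + 2, hk⟩, false), 0) := by
    -- The square `k + 1` has `k` above it and `k + 2` to its right; each of these is glued to
    -- itself in the remaining direction.
    intro k hk h
    exact (rel (b := ⟨k + 1, by omega⟩) (r := ⟨k + 2, hk⟩) (u := ⟨k, by omega⟩)
      (stairRight_succ (by simp only; omega) rfl) (stairUp_pred (by simp only; omega) rfl)
      (stairUp_self (by simp only; omega)) (stairRight_self (by simp only; omega))).symm
  suffices H : ∀ (k : ℕ) (hk : k < 2 * g - 1),
      (staircase g n).SameVertex ((⟨0, by omega⟩, false), 0) ((⟨k, hk⟩, false), 0) from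
    fun b => H b.1 b.2
  intro k
  induction k using Nat.strong_induction_on with
  | _ k ih =>
  intro hk
  have h4 : k % 4 = 0 ∨ k % 4 = 1 ∨ k % 4 = 2 ∨ k % 4 = 3 := by omega
  rcases h4 with h | h | h | h
  · obtain rfl | ⟨j, rfl⟩ : k = 0 ∨ ∃ j, k = j + 4 := by
      rcases Nat.eq_zero_or_pos k with h0 | h0
      · exact Or.inl h0
      · exact Or.inr ⟨k - 4, by omega⟩
    · exact Relation.EqvGen.refl _
    · refine (ih j (by omega) (by omega)).trans ?_
      -- The vertical cylinder through `j + 4` has a third rectangle `j + 5` unless the staircase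
      -- ends at `j + 4`; only in the first case is there a detour through `j + 6`.
      by_cases hk2 : j + 6 < 2 * g - 1
      · refine (rel (b := ⟨j + 3, by omega⟩) (r := ⟨j + 1, by omega⟩) (u := ⟨j + 5, by omega⟩)
          (l := ⟨j + 6, hk2⟩)
          (stairRight_pred_pred (by simp only; omega) rfl)
          (stairUp_add_two (by simp only; omega) rfl)
          (stairUp_pred (by simp only; omega) rfl)
          (stairRight_succ (by simp only; omega) rfl)).trans (even (j + 4) hk2 h).symm
      · exact rel (b := ⟨j + 3, by omega⟩) (r := ⟨j + 1, by omega⟩) (u := ⟨j + 4, by omega⟩)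
          (stairRight_pred_pred (by simp only; omega) rfl)
          (stairUp_succ (by simp only; omega) (by simp only; omega) rfl)
          (stairUp_pred (by simp only; omega) rfl)
          (stairRight_self (by simp only; omega))
  · obtain rfl | ⟨j, rfl⟩ : k = 1 ∨ ∃ j, k = j + 5 := by
      rcases Nat.lt_or_ge k 5 with h0 | h0
      · exact Or.inl (by omega)
      · exact Or.inr ⟨k - 5, by omega⟩
    · refine (even 0 (by omega) rfl).trans (SameVertex.symm ?_)
      exact rel (b := ⟨0, by omega⟩) (r := ⟨0, by omega⟩) (u := ⟨1, by omega⟩)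
        (stairRight_self rfl) (stairUp_zero rfl rfl) (stairUp_zero rfl rfl)
        (stairRight_succ (Or.inl rfl) rfl)
    · refine (ih (j + 3) (by omega) (by omega)).trans (SameVertex.symm ?_)
      exact rel (b := ⟨j + 2, by omega⟩) (r := ⟨j + 3, by omega⟩) (u := ⟨j + 2, by omega⟩)
        (stairRight_succ (by simp only; omega) rfl) (stairUp_self (by simp only; omega))
        (stairUp_add_two (by simp only; omega) rfl) (stairRight_succ (by simp only; omega) rfl)
  · obtain ⟨j, rfl⟩ : ∃ j, k = j + 2 := ⟨k - 2, by omega⟩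
    exact (ih j (by omega) (by omega)).trans (even j hk (by omega))
  · obtain ⟨j, rfl⟩ : ∃ j, k = j + 2 := ⟨k - 2, by omega⟩
    refine (ih j (by omega) (by omega)).trans (SameVertex.symm ?_)
    exact rel (b := ⟨j + 3, by omega⟩) (r := ⟨j + 3, by omega⟩) (u := ⟨j + 2, by omega⟩)
      (stairRight_self (by simp only; omega)) (stairUp_pred (by simp only; omega) rfl)
      (stairUp_pred (by simp only; omega) rfl) (stairRight_pred_pred (by simp only; omega) rfl)

/-- All corners of the `2(2g - 1)` triangles lie at one vertex, and each triangle contributes `π`.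
-/
theorem staircase_mem_minimalStratum (hg : 2 ≤ g) (n : ℕ+) :
    staircase g n ∈ minimalStratum g := by
  refine ⟨staircase_isConnected g n, ((⟨0, by omega⟩, false), 0), ?_,
    fun c hc => absurd (staircase_sameVertex hg c) hc⟩
  rw [coneAngle_of_forall_sameVertex fun c => staircase_sameVertex hg c]
  have : Fintype.card (staircase g n).T = (2 * g - 1) * 2 := by
    change Fintype.card (Fin (2 * g - 1) × Bool) = _
    simp
  rw [this]
  push_cast [Nat.cast_sub (show 1 ≤ 2 * g by omega)]
  ring

/-! ### Closed forms on the staircase -/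

theorem stairWidth_mul_stairHeight (n : ℕ+) (k : ℕ) :
    stairWidth n k * stairHeight n k = if k % 2 = 0 then (n : ℝ) else 1 := by
  simp only [stairWidth, stairHeight]
  grind

theorem vol_staircase (hg : 1 ≤ g) (n : ℕ+) : (staircase g n).vol = g * ((n : ℝ) + 1) - 1 := by
  rw [staircase, vol_ofRectangles]
  simp only [stairWidth_mul_stairHeight]
  rw [Fin.sum_univ_eq_sum_range (fun k => if k % 2 = 0 then (n : ℝ) else 1)]
  induction g, hg using Nat.le_induction with
  | base => simp
  | succ g hg ih =>
    rw [show 2 * (g + 1) - 1 = (2 * g - 1) + 1 + 1 by omega, Finset.sum_range_succ,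
      Finset.sum_range_succ, ih, if_neg (by omega), if_pos (by omega)]
    push_cast
    ring

/-- A closed form on the staircase agrees on the two triangles of each rectangle. -/
theorem ClosedForm.cov_true_eq_cov_false (φ : (staircase g n).ClosedForm)
    (b : Fin (2 * g - 1)) : φ.cov (b, true) 1 = φ.cov (b, false) 1 ∧
      φ.cov (b, true) Complex.I = φ.cov (b, false) Complex.I := by
  have hup : ∀ {a b : Fin (2 * g - 1)}, stairUp g a = b →
      φ.cov (b, false) 1 = φ.cov (a, true) 1 := by
    rintro a _ rfl; exact φ.cov_up_one a
  have hright : ∀ {a b : Fin (2 * g - 1)}, stairRight g a = b →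
      φ.cov (b, true) Complex.I = φ.cov (a, false) Complex.I := by
    rintro a _ rfl; exact φ.cov_right_I a
  have of_one : ∀ b : Fin (2 * g - 1), φ.cov (b, true) 1 = φ.cov (b, false) 1 →
      φ.cov (b, true) 1 = φ.cov (b, false) 1 ∧
      φ.cov (b, true) Complex.I = φ.cov (b, false) Complex.I :=
    fun b h => ⟨h, ((φ.cov_one_iff_cov_I b).1 h.symm).symm⟩
  have of_I : ∀ b : Fin (2 * g - 1), φ.cov (b, true) Complex.I = φ.cov (b, false) Complex.I →
      φ.cov (b, true) 1 = φ.cov (b, false) 1 ∧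
      φ.cov (b, true) Complex.I = φ.cov (b, false) Complex.I :=
    fun b h => ⟨((φ.cov_one_iff_cov_I b).2 h.symm).symm, h⟩
  suffices H : ∀ (k : ℕ) (hk : k < 2 * g - 1),
      φ.cov ((⟨k, hk⟩, true) : Fin (2 * g - 1) × Bool) 1
        = φ.cov ((⟨k, hk⟩, false) : Fin (2 * g - 1) × Bool) 1 ∧
      φ.cov ((⟨k, hk⟩, true) : Fin (2 * g - 1) × Bool) Complex.I
        = φ.cov ((⟨k, hk⟩, false) : Fin (2 * g - 1) × Bool) Complex.I from H b.1 b.2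
  intro k
  induction k using Nat.strong_induction_on with
  | _ k ih =>
  intro hk
  -- A long rectangle is glued to itself in one direction, which gives one coefficient; the diagonal
  -- gives the other. For a square, the coefficient is carried around a cylinder whose other members
  -- are already settled.
  have h4 : k % 4 = 0 ∨ k % 4 = 1 ∨ k % 4 = 2 ∨ k % 4 = 3 := by omega
  rcases h4 with h | h | h | h
  · exact of_I _ (hright (stairRight_self h))
  · obtain rfl | ⟨j, rfl⟩ : k = 1 ∨ ∃ j, k = j + 5 := by
      rcases Nat.lt_or_ge k 5 with h0 | h0
      · exact Or.inl (by omega)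
      · exact Or.inr ⟨k - 5, by omega⟩
    · refine of_one _ ?_
      rw [hup (stairUp_zero (k := ⟨0, by omega⟩) rfl rfl), (ih 0 (by omega) (by omega)).1]
      exact (hup (stairUp_pred (Or.inr rfl) rfl)).symm
    · refine of_one _ ?_
      rw [← hup (stairUp_pred (l := ⟨j + 4, by omega⟩) (by simp only; omega) rfl),
        ← (ih (j + 4) (by omega) (by omega)).1,
        ← hup (stairUp_pred (l := ⟨j + 3, by omega⟩) (by simp only; omega) rfl),
        ← (ih (j + 3) (by omega) (by omega)).1]
      exact (hup (stairUp_add_two (by simp only; omega) rfl)).symm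
  · exact of_one _ (hup (stairUp_self h)).symm
  · obtain ⟨j, rfl⟩ : ∃ j, k = j + 2 := ⟨k - 2, by omega⟩
    refine of_I _ ?_
    rw [hright (stairRight_succ (k := ⟨j + 1, by omega⟩) (by simp only; omega) rfl),
      ← (ih (j + 1) (by omega) (by omega)).2,
      hright (stairRight_succ (k := ⟨j, by omega⟩) (by simp only; omega) rfl),
      ← (ih j (by omega) (by omega)).2]
    exact hright (stairRight_pred_pred (by simp only; omega) rfl)

theorem ClosedForm.cov_stairUp_one (φ : (staircase g n).ClosedForm) (b : Fin (2 * g - 1)) :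
    φ.cov (stairUp g b, false) 1 = φ.cov (b, false) 1 :=
  (φ.cov_up_one b).trans (φ.cov_true_eq_cov_false b).1

theorem ClosedForm.cov_stairRight_I (φ : (staircase g n).ClosedForm) (b : Fin (2 * g - 1)) :
    φ.cov (stairRight g b, false) Complex.I = φ.cov (b, false) Complex.I :=
  (φ.cov_true_eq_cov_false _).2.symm.trans (φ.cov_right_I b)

/-! ### Weights representing evaluation at a rectangle -/

/-- The weight `1 / n` on the rectangle `u`. -/
def stairDelta (n : ℕ+) (u k : ℕ) : ℝ := if k = u then 1 / (n : ℝ) else 0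

/-- The weight that is `1 / n` on the long cylinder through the rectangle `u`, corrected on the
long rectangles of the crossing cylinders so that these are not charged. -/
def stairWeight (n : ℕ+) (u k : ℕ) : ℝ :=
  if k = u ∨ k = u + 1 ∨ k + 1 = u then 1 / (n : ℝ)
  else if k = u + 2 ∨ k + 2 = u then -(1 / (n : ℝ) ^ 2) else 0

theorem abs_stairDelta_le (n : ℕ+) (u k : ℕ) : |stairDelta n u k| ≤ 1 / (n : ℝ) := by
  unfold stairDelta
  split_ifs
  · rw [abs_of_nonneg (by positivity)]
  · simp

theorem abs_stairWeight_le (n : ℕ+) (u k : ℕ) : |stairWeight n u k| ≤ 1 / (n : ℝ) := by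
  have hn : (1 : ℝ) ≤ (n : ℝ) := by exact_mod_cast Nat.one_le_iff_ne_zero.2 n.ne_zero
  unfold stairWeight
  split_ifs
  · rw [abs_of_nonneg (by positivity)]
  · rw [abs_neg, abs_of_nonneg (by positivity)]
    exact one_div_le_one_div_of_le (by positivity) (le_self_pow₀ hn two_ne_zero)
  · simp

theorem stairDelta_stairRight {u : ℕ} (hu : u % 4 = 0) (b : Fin (2 * g - 1)) :
    stairDelta n u (stairRight g b) = stairDelta n u b := by
  have := b.2
  simp only [stairDelta, stairRight, Equiv.coe_fn_mk]
  grind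

theorem stairDelta_stairUp {u : ℕ} (hu : u % 4 = 2) (b : Fin (2 * g - 1)) :
    stairDelta n u (stairUp g b) = stairDelta n u b := by
  obtain ⟨b, rfl⟩ := (stairDown g).surjective b
  have := b.2
  rw [Equiv.symm_apply_apply]
  simp only [stairDelta, stairDown, Equiv.coe_fn_mk]
  grind

theorem stairWeight_stairUp {u : ℕ} (hu : u % 4 = 0) (b : Fin (2 * g - 1)) :
    stairWeight n u (stairUp g b) = stairWeight n u b := by
  obtain ⟨b, rfl⟩ := (stairDown g).surjective b
  have := b.2
  rw [Equiv.symm_apply_apply]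
  simp only [stairWeight, stairDown, Equiv.coe_fn_mk]
  grind

theorem stairWeight_stairRight {u : ℕ} (hu : u % 4 = 2) (b : Fin (2 * g - 1)) :
    stairWeight n u (stairRight g b) = stairWeight n u b := by
  have := b.2
  simp only [stairWeight, stairRight, Equiv.coe_fn_mk]
  grind

theorem sum_mul_stairDelta {u : Fin (2 * g - 1)} (hu : u.1 % 2 = 0) (f : Fin (2 * g - 1) → ℝ) :
    ∑ b : Fin (2 * g - 1), stairWidth n b * stairHeight n b * (f b * stairDelta n u b) = f u := by
  have hn : (n : ℝ) ≠ 0 := by positivity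
  rw [Finset.sum_eq_single u]
  · rw [stairWidth_mul_stairHeight, if_pos hu, stairDelta, if_pos rfl]
    field_simp
  · intro b _ hb
    rw [stairDelta, if_neg (Fin.val_ne_of_ne hb)]
    ring
  · simp

/-- The rectangle `u` has area `n` and contributes `f u`. An adjacent square contributes `f c / n`,
and the long rectangle `l` beyond it contributes `-f l / n`; these cancel because `f c = f l`. -/
theorem sum_mul_stairWeight {u : Fin (2 * g - 1)} (hu : u.1 % 2 = 0) (f : Fin (2 * g - 1) → ℝ)
    (hf : ∀ c l : Fin (2 * g - 1),
      (c.1 = u + 1 ∧ l.1 = u + 2 ∨ c.1 + 1 = u ∧ l.1 + 2 = u) → f c = f l) :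
    ∑ b : Fin (2 * g - 1), stairWidth n b * stairHeight n b * (f b * stairWeight n u b) = f u := by
  have hn : (n : ℝ) ≠ 0 := by positivity
  obtain ⟨u, hug⟩ := u
  simp only at hu hf
  -- Extension by zero treats the end of the staircase uniformly: the square `u + 1` and the
  -- rectangle `u + 2` are present or absent together.
  set F : ℕ → ℝ := fun k => if h : k < 2 * g - 1 then f ⟨k, h⟩ else 0 with hF
  have hFf : ∀ b : Fin (2 * g - 1), f b = F b := fun b => by simp [hF]
  have h1 : F (u + 1) = F (u + 2) := by
    by_cases h : u + 2 < 2 * g - 1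
    · rw [hF]; simp only [h, show u + 1 < 2 * g - 1 by omega, dif_pos]
      exact hf _ _ (Or.inl ⟨rfl, rfl⟩)
    · rw [hF]; simp only [h, show ¬ u + 1 < 2 * g - 1 by omega, dif_neg, not_false_iff]
  have h2 : ∀ v, u = v + 2 → F (v + 1) = F v := by
    rintro v rfl
    rw [hF]; simp only [show v + 1 < 2 * g - 1 by omega, show v < 2 * g - 1 by omega, dif_pos]
    exact hf _ _ (Or.inr ⟨rfl, rfl⟩)
  simp only [hFf, stairWidth_mul_stairHeight]
  rw [Fin.sum_univ_eq_sum_range (fun k => (if k % 2 = 0 then (n : ℝ) else 1) *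
    (F k * stairWeight n u k))]
  obtain rfl | ⟨v, rfl⟩ : u = 0 ∨ ∃ v, u = v + 2 := by
    rcases Nat.lt_or_ge u 2 with h | h
    · exact Or.inl (by omega)
    · exact Or.inr ⟨u - 2, by omega⟩
  · have : ∀ k, (if k % 2 = 0 then (n : ℝ) else 1) * (F k * stairWeight n 0 k) =
        (if k = 0 then F 0 else 0) + (if k = 1 then F 1 / n else 0)
          - (if k = 2 then F 2 / n else 0) := by
      intro k
      simp only [stairWeight]
      grind
    simp only [this, Finset.sum_add_distrib, Finset.sum_sub_distrib, Finset.sum_ite_eq',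
      Finset.mem_range, hug, if_true]
    simp only [zero_add] at h1
    rw [h1]
    have : 1 < 2 * g - 1 ↔ 2 < 2 * g - 1 := by omega
    simp [this]
  · have : ∀ k, (if k % 2 = 0 then (n : ℝ) else 1) * (F k * stairWeight n (v + 2) k) =
        (if k = v + 2 then F (v + 2) else 0) + (if k = v + 3 then F (v + 3) / n else 0)
          - (if k = v + 4 then F (v + 4) / n else 0) + (if k = v + 1 then F (v + 1) / n else 0)
          - (if k = v then F v / n else 0) := by
      intro k
      simp only [stairWeight]
      grind
    simp only [this, Finset.sum_add_distrib, Finset.sum_sub_distrib, Finset.sum_ite_eq',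
      Finset.mem_range, hug, if_true]
    have h3 : F (v + 3) = F (v + 4) := h1
    have h4 : v + 3 < 2 * g - 1 ↔ v + 4 < 2 * g - 1 := by omega
    rw [h2 v rfl, h3]
    simp only [h4, show v + 1 < 2 * g - 1 by omega, show v < 2 * g - 1 by omega, if_true]
    ring

/-- Evaluation at a rectangle, for functions constant on horizontal cylinders, is represented by a
small function constant on vertical cylinders. -/
theorem exists_stairUp_invariant_weight (n : ℕ+) (b₀ : Fin (2 * g - 1)) :
    ∃ P : Fin (2 * g - 1) → ℝ, (∀ b, P (stairUp g b) = P b) ∧ (∀ b, |P b| ≤ 1 / (n : ℝ)) ∧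
      ∀ f : Fin (2 * g - 1) → ℝ, (∀ b, f (stairRight g b) = f b) →
        ∑ b : Fin (2 * g - 1), stairWidth n b * stairHeight n b * (f b * P b) = f b₀ := by
  have hb := b₀.2
  have h4 : b₀.1 % 4 = 0 ∨ b₀.1 % 4 = 1 ∨ b₀.1 % 4 = 2 ∨ b₀.1 % 4 = 3 := by omega
  rcases h4 with h | h | h | h
  -- An upright rectangle is alone in its horizontal cylinder, so its whole vertical cylinder must
  -- be weighted. Invariance of `f` along horizontal cylinders provides the cancellation.
  · refine ⟨fun b => stairWeight n b₀ b, stairWeight_stairUp h, fun b => abs_stairWeight_le n _ _,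
      fun f hf => sum_mul_stairWeight (by omega) f ?_⟩
    rintro c l (⟨hc, hl⟩ | ⟨hc, hl⟩)
    · rw [← hf c, stairRight_succ (l := l) (by omega) (by omega)]
    · rw [← hf l, stairRight_succ (l := c) (by omega) (by omega)]
  -- The value of `f` at a square is its value at the lying rectangle of the same horizontal
  -- cylinder, and that rectangle is a vertical cylinder by itself.
  · refine ⟨fun b => stairDelta n (b₀.1 + 1) b, stairDelta_stairUp (u := b₀.1 + 1) (by omega),
      fun b => abs_stairDelta_le n _ _, fun f hf => ?_⟩
    rw [← hf b₀, stairRight_succ (l := ⟨b₀ + 1, by omega⟩) (by omega) rfl]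
    exact sum_mul_stairDelta (u := ⟨b₀ + 1, by omega⟩) (by simp only; omega) f
  · exact ⟨fun b => stairDelta n b₀ b, stairDelta_stairUp h, fun b => abs_stairDelta_le n _ _,
      fun f _ => sum_mul_stairDelta (by omega) f⟩
  · refine ⟨fun b => stairDelta n (b₀.1 - 1) b, stairDelta_stairUp (u := b₀.1 - 1) (by omega),
      fun b => abs_stairDelta_le n _ _, fun f hf => ?_⟩
    rw [show f b₀ = f ⟨b₀ - 1, by omega⟩ by
      rw [← hf ⟨b₀ - 1, _⟩, stairRight_succ (l := b₀) (by simp only; omega) (by simp only; omega)]]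
    exact sum_mul_stairDelta (u := ⟨b₀ - 1, by omega⟩) (by simp only; omega) f

/-- Evaluation at a rectangle, for functions constant on vertical cylinders, is represented by a
small function constant on horizontal cylinders. -/
theorem exists_stairRight_invariant_weight (n : ℕ+) (b₀ : Fin (2 * g - 1)) :
    ∃ Q : Fin (2 * g - 1) → ℝ, (∀ b, Q (stairRight g b) = Q b) ∧ (∀ b, |Q b| ≤ 1 / (n : ℝ)) ∧
      ∀ f : Fin (2 * g - 1) → ℝ, (∀ b, f (stairUp g b) = f b) →
        ∑ b : Fin (2 * g - 1), stairWidth n b * stairHeight n b * (f b * Q b) = f b₀ := by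
  have hb := b₀.2
  have h4 : b₀.1 % 4 = 0 ∨ b₀.1 % 4 = 1 ∨ b₀.1 % 4 = 2 ∨ b₀.1 % 4 = 3 := by omega
  rcases h4 with h | h | h | h
  · exact ⟨fun b => stairDelta n b₀ b, stairDelta_stairRight h, fun b => abs_stairDelta_le n _ _,
      fun f _ => sum_mul_stairDelta (by omega) f⟩
  · refine ⟨fun b => stairDelta n (b₀.1 - 1) b, stairDelta_stairRight (u := b₀.1 - 1) (by omega),
      fun b => abs_stairDelta_le n _ _, fun f hf => ?_⟩
    rw [← hf b₀, stairUp_pred (l := ⟨b₀ - 1, by omega⟩) (by omega) (by simp only; omega)]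
    exact sum_mul_stairDelta (u := ⟨b₀ - 1, by omega⟩) (by simp only; omega) f
  · refine ⟨fun b => stairWeight n b₀ b, stairWeight_stairRight h,
      fun b => abs_stairWeight_le n _ _, fun f hf => sum_mul_stairWeight (by omega) f ?_⟩
    rintro c l (⟨hc, hl⟩ | ⟨hc, hl⟩)
    · rw [← hf l, stairUp_pred (l := c) (by omega) (by omega)]
    · rw [← hf c, stairUp_pred (l := l) (by omega) (by omega)]
  · refine ⟨fun b => stairDelta n (b₀.1 + 1) b, stairDelta_stairRight (u := b₀.1 + 1) (by omega),
      fun b => abs_stairDelta_le n _ _, fun f hf => ?_⟩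
    rw [show f b₀ = f ⟨b₀ + 1, by omega⟩ by
      rw [← hf ⟨b₀ + 1, _⟩, stairUp_pred (l := b₀) (by simp only; omega) rfl]]
    exact sum_mul_stairDelta (u := ⟨b₀ + 1, by omega⟩) (by simp only; omega) f

/-! ### The value of `KVol` -/

theorem ClosedForm.wedge_stair_rectForm (φ : (staircase g n).ClosedForm)
    {P Q : Fin (2 * g - 1) → ℝ} (hP : ∀ b, P (stairUp g b) = P b)
    (hQ : ∀ b, Q (stairRight g b) = Q b) :
    φ.wedge (rectForm P Q hP hQ) =
      ∑ b : Fin (2 * g - 1), stairWidth n b * stairHeight n b * (φ.cov (b, false) 1 * Q b) -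
      ∑ b : Fin (2 * g - 1),
        stairWidth n b * stairHeight n b * (φ.cov (b, false) Complex.I * P b) := by
  refine (φ.wedge_rectForm φ.cov_true_eq_cov_false).trans ?_
  rw [← Finset.sum_sub_distrib]
  exact Finset.sum_congr rfl fun b _ => by ring

/-- The comass of the Poincaré dual of a curve is at most `1 / n` times its length. -/
theorem ClosedForm.IsDual.enorm_cov_le {η : (staircase g n).ClosedForm}
    {β : (staircase g n).ClosedCurve} (h : η.IsDual β) (t : (staircase g n).T) (v : ℂ) :
    ‖η.cov t v‖ₑ ≤ ENNReal.ofReal (1 / (n : ℝ)) * β.length * ‖v‖ₑ := by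
  obtain ⟨b₀, i⟩ : Fin (2 * g - 1) × Bool := t
  obtain ⟨P, hP, hPn, hPf⟩ := exists_stairUp_invariant_weight n b₀
  obtain ⟨Q, hQ, hQn, hQf⟩ := exists_stairRight_invariant_weight n b₀
  -- Chosen so that `∫ η ∧ φ` picks out `v.re` times the `dx`-coefficient plus `v.im` times the
  -- `dy`-coefficient of `η` at `b₀`.
  set φ : (staircase g n).ClosedForm := rectForm (fun b => -v.im * P b) (fun b => v.re * Q b)
    (fun b => by rw [hP]) (fun b => by rw [hQ]) with hφ
  have hcov : η.cov (b₀, i) v = η.wedge φ := by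
    have hi : η.cov (b₀, i) v = η.cov (b₀, false) 1 * v.re + η.cov (b₀, false) Complex.I * v.im := by
      conv_lhs => rw [show v = v.re • (1 : ℂ) + v.im • Complex.I by simp]
      rw [map_add, map_smul, map_smul]
      cases i
      · simp only [smul_eq_mul]; ring
      · rw [(η.cov_true_eq_cov_false b₀).1, (η.cov_true_eq_cov_false b₀).2]
        simp only [smul_eq_mul]; ring
    rw [hi, hφ, η.wedge_stair_rectForm,
      ← hPf (fun b => η.cov (b, false) Complex.I) η.cov_stairRight_I,
      ← hQf (fun b => η.cov (b, false) 1) η.cov_stairUp_one, Finset.sum_mul, Finset.sum_mul,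
      sub_eq_add_neg, ← Finset.sum_neg_distrib]
    congr 1 <;> exact Finset.sum_congr rfl fun b _ => by ring
  rw [hcov]
  have hM : ∀ b, (-v.im * P b) ^ 2 + (v.re * Q b) ^ 2 ≤ (1 / (n : ℝ) * ‖v‖) ^ 2 := by
    intro b
    have h1 := sq_le_sq' (neg_le_of_abs_le (hPn b)) (le_of_abs_le (hPn b))
    have h2 := sq_le_sq' (neg_le_of_abs_le (hQn b)) (le_of_abs_le (hQn b))
    rw [mul_pow _ ‖v‖, Complex.sq_norm, Complex.normSq_apply]
    nlinarith [mul_le_mul_of_nonneg_left h1 (sq_nonneg v.im),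
      mul_le_mul_of_nonneg_left h2 (sq_nonneg v.re)]
  refine ((h φ).enorm_le (enorm_rectForm_cov_le (by positivity) hM)).trans (le_of_eq ?_)
  rw [ENNReal.ofReal_mul (by positivity), ofReal_norm]
  ring

theorem KVol_staircase_le (hg : 1 ≤ g) (n : ℕ+) :
    (staircase g n).KVol ≤ ENNReal.ofReal (((g : ℝ) * ((n : ℝ) + 1) - 1) / (n : ℝ)) := by
  have hg' : (1 : ℝ) ≤ g := by exact_mod_cast hg
  have hv : 0 ≤ (g : ℝ) * ((n : ℝ) + 1) - 1 := by
    nlinarith [show (0 : ℝ) < n by positivity]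
  rw [KVol, vol_staircase hg, div_eq_mul_one_div, ENNReal.ofReal_mul hv]
  gcongr
  -- Clearing the denominator in this direction needs no positivity, so curves of length zero are
  -- included.
  refine iSup_le fun α => iSup_le fun β => iSup_le fun k => iSup_le fun ⟨η, hη, hk⟩ =>
    ENNReal.div_le_of_le_mul ?_
  calc ENNReal.ofReal k ≤ ‖k‖ₑ := by
        rw [Real.enorm_eq_ofReal_abs]; exact ENNReal.ofReal_le_ofReal (le_abs_self k)
    _ ≤ ENNReal.ofReal (1 / (n : ℝ)) * β.length * α.length := hk.enorm_le hη.enorm_cov_le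
    _ = _ := by ring

/-- Tested on the bottom side `α` and the right side `β` of the first rectangle. -/
theorem le_KVol_staircase (hg : 2 ≤ g) (n : ℕ+) :
    ENNReal.ofReal (((g : ℝ) * ((n : ℝ) + 1) - 1) / (n : ℝ)) ≤ (staircase g n).KVol := by
  have hn : (0 : ℝ) < n := by positivity
  have hg' : (2 : ℝ) ≤ g := by exact_mod_cast hg
  have hv : 0 ≤ (g : ℝ) * ((n : ℝ) + 1) - 1 := by nlinarith
  rw [KVol, vol_staircase (by omega), div_eq_mul_one_div, ENNReal.ofReal_mul hv]
  gcongr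
  set o : Fin (2 * g - 1) := ⟨0, by omega⟩ with ho
  have hloop : ∀ c c' : (Fin (2 * g - 1) × Bool) × Fin 3, (staircase g n).SameVertex c c' :=
    fun c c' => (staircase_sameVertex hg c).symm.trans (staircase_sameVertex hg c')
  set α := (staircase g n).edgeLoop ((o, false), 0) (hloop _ _) with hα
  set β := (staircase g n).edgeLoop ((o, false), 1) (hloop _ _) with hβ
  -- The dual of `β`: `dx` on the first vertical cylinder and `-(1 / n) dx` on the next lying
  -- rectangle, so that wedging with `φ` leaves `n` times the `dy`-coefficient of `φ` at `o`, its
  -- integral along `β`.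
  set η : (staircase g n).ClosedForm :=
    rectForm (fun b => n * stairWeight n 0 b) (fun _ => 0)
      (fun b => by rw [stairWeight_stairUp rfl]) (fun _ => rfl) with hη
  have hsα : (staircase g n).side ((o, false), 0) = 1 := by
    refine (side_bottom o).trans ?_
    simp [ho, stairWidth]
  have hsβ : (staircase g n).side ((o, false), 1) = (n : ℝ) • Complex.I := by
    refine (side_right o).trans ?_
    simp [ho, stairHeight]
  have hdual : η.IsDual β := by
    intro φ
    have : η.wedge φ = φ.cov (o, false) ((staircase g n).side ((o, false), 1)) := by
      rw [hsβ, map_smul, smul_eq_mul, ClosedForm.wedge_comm, hη, φ.wedge_stair_rectForm,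
        ← sum_mul_stairWeight (n := n) (u := o) rfl (fun b => φ.cov (b, false) Complex.I),
        Finset.mul_sum]
      · simp only [mul_zero, Finset.sum_const_zero, zero_sub, neg_neg]
        exact Finset.sum_congr rfl fun b _ => by ring
      · rintro c l (⟨hc, hl⟩ | ⟨hc, hl⟩)
        · rw [← φ.cov_stairRight_I c, stairRight_succ (l := l) (by simp [ho] at hc; omega) (by omega)]
        · simp [ho] at hc
    rw [this]
    exact hasIntegral_edgeLoop φ _ _
  have hint : α.HasInt β 1 := by
    refine ⟨η, hdual, ?_⟩
    have := hasIntegral_edgeLoop η ((o, false), 0) (hloop _ _)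
    have h1 : η.cov (o, false) ((staircase g n).side ((o, false), 0)) = 1 := by
      rw [hsα]
      refine (rectForm_cov o false 1).trans ?_
      simp [ho, stairWeight]
    rwa [h1] at this
  refine le_iSup_of_le α (le_iSup_of_le β (le_iSup_of_le 1 (le_iSup_of_le hint ?_)))
  rw [hα, hβ, length_edgeLoop, length_edgeLoop, hsα, hsβ, enorm_smul]
  rw [Real.enorm_eq_ofReal_abs, abs_of_pos hn, ENNReal.ofReal_div_of_pos hn,
    ← ofReal_norm (1 : ℂ), ← ofReal_norm Complex.I]
  simp

theorem KVol_staircase (hg : 2 ≤ g) (n : ℕ+) :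
    (staircase g n).KVol = ENNReal.ofReal (((g : ℝ) * ((n : ℝ) + 1) - 1) / (n : ℝ)) :=
  le_antisymm (KVol_staircase_le (by omega) n) (le_KVol_staircase hg n)

theorem tendsto_KVol_staircase (hg : 2 ≤ g) :
    Tendsto (fun n : ℕ+ => (staircase g n).KVol) atTop (𝓝 (g : ℝ≥0∞)) := by
  simp only [KVol_staircase hg]
  rw [← ENNReal.ofReal_natCast]
  refine ENNReal.tendsto_ofReal ?_
  have h1 : Tendsto (fun n : ℕ+ => ((n : ℕ) : ℝ)) atTop atTop :=
    tendsto_natCast_atTop_atTop.comp tendsto_PNat_val_atTop_atTop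
  -- The value is `g + (g - 1) / n`.
  have h2 := (h1.inv_tendsto_atTop.const_mul ((g : ℝ) - 1)).const_add (g : ℝ)
  rw [mul_zero, add_zero] at h2
  refine h2.congr fun n => ?_
  have hn : (n : ℝ) ≠ 0 := by positivity
  simp only [Pi.inv_apply]
  field_simp
  ring

end Staircase

end TranslationSurface

end

theorem theorem1 (g : ℕ) (hg : 2 ≤ g) :
    TranslationSurface.infKVol (TranslationSurface.minimalStratum g) ≤ (g : ℝ≥0∞) ∧
    (∀ n : ℕ+, 2 ≤ n →
      TranslationSurface.staircase g n ∈ TranslationSurface.minimalStratum g ∧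
      (TranslationSurface.staircase g n).vol = (g : ℝ) * ((n : ℝ) + 1) - 1 ∧
      ENNReal.ofReal (((g : ℝ) * ((n : ℝ) + 1) - 1) / (n : ℝ)) ≤
        (TranslationSurface.staircase g n).KVol ∧
      (TranslationSurface.staircase g n).KVol ≤
        ENNReal.ofReal (((g : ℝ) * ((n : ℝ) + 1) - 1) *
          (((n : ℝ) + 1) ^ 2 / (n : ℝ) ^ 3 + 6 / (n : ℝ) ^ 2))) ∧
    Tendsto (fun n : ℕ+ => (TranslationSurface.staircase g n).KVol) atTop
      (𝓝 (g : ℝ≥0∞)) := by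
  open TranslationSurface in
  refine ⟨?_, fun n _ => ⟨staircase_mem_minimalStratum hg n, vol_staircase (by omega) n,
    le_KVol_staircase hg n, (KVol_staircase_le (by omega) n).trans ?_⟩,
    tendsto_KVol_staircase hg⟩
  · exact ge_of_tendsto' (tendsto_KVol_staircase hg) fun n =>
      iInf₂_le _ (staircase_mem_minimalStratum hg n)
  · have hn : (0 : ℝ) < n := by positivity
    have hg' : (2 : ℝ) ≤ g := by exact_mod_cast hg
    have hv : 0 ≤ (g : ℝ) * ((n : ℝ) + 1) - 1 := by nlinarith
    rw [div_eq_mul_one_div]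
    refine ENNReal.ofReal_le_ofReal (mul_le_mul_of_nonneg_left ?_ hv)
    -- The exact factor `1 / n` is already below the first summand of the stated bound.
    calc 1 / (n : ℝ) = (n : ℝ) ^ 2 / (n : ℝ) ^ 3 := by field_simp
      _ ≤ ((n : ℝ) + 1) ^ 2 / (n : ℝ) ^ 3 := by gcongr; linarith
      _ ≤ _ := le_add_of_nonneg_right (by positivity)
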